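/- **Setting.** Let $I$ be a finite set of agents and $\Theta$ a compact space. For a topological space $X$ let $\Delta(X)$ be the space of regular Borel probability measures on $X$ (if $X$ is compact metrizable these are all Borel probability measures), with the topology of weak convergence, and write $X_{-i} := \prod_{j \neq i} X_j$. Put $\Omega^1_i := \Theta$, $T^1_i := \Delta(\Theta)$ and, for $m \ge 1$, $$\Omega^{m+1}_i := \Theta \times T^m_{-i}, \qquad T^{m+1}_i := \{ (t, \mu) \in T^m_i \times \Delta(\Omega^{m+1}_i) : \mathrm{marg}_{\Omega^m_i}\, \mu \text{ is the last entry of } t \}.$$ Let $T^*_i := \varprojlim_m T^m_i$ be the universal type space of agent $i$. For $t = (\mu^1, \mu^2, \dots) \in T^*_i$, the belief $\beta^*_i(t)$ is the probability measure on $\Theta \times T^*_{-i}$ whose marginal on $\Omega^m_i$ is $\mu^m$ for every $m \ge 1$. A *state space* is a nonempty compact set $\Omega = \Theta \times \prod_{j} T_j \subseteq \Theta \times \prod_{j} T^*_j$ (not necessarily belief-closed). Given a state space $\Omega$ and an agent $i$, an *agent-$i$-dependent type structure* induced by $T_i$ consists of nonempty compact sets $\mathbf{T}^i_j \subseteq T^*_j$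 and continuous belief functions $\boldsymbol\beta^i_j : \mathbf{T}^i_j \to \Delta(\Theta \times \mathbf{T}^i_{-j})$ ($j \in I$) that are the restrictions of $\beta^*_j$ (that is, the image of $\boldsymbol\beta^i_j(t)$ under the inclusion $\Theta \times \mathbf{T}^i_{-j} \subseteq \Theta \times T^*_{-j}$ is the belief $\beta^*_j(t)$), such that $T_i \subseteq \mathbf{T}^i_i$. The elements of $T_i$ are the *real* types of agent $i$. Let $\Upomega^i := \Theta \times \prod_j \mathbf{T}^i_j$ be the agent-$i$-dependent state space. Agent $i$ knows her own type. Accordingly, for a set of states $E \subseteq \Upomega^i$, $$\mathrm{Bel}_i(E) := \{ t_i \in \mathbf{T}^i_i : \boldsymbol\beta^i_i(t_i)(E_{t_i}) = 1 \}, \qquad E_{t_i} := \{ (\theta, t_{-i}) : (\theta, t_i, t_{-i}) \in E \}, \qquad B_i(E) := \mathrm{Bel}_i(E) \cap T_i .$$ A set $E_{-i} \subseteq \Theta \times \mathbf{T}^i_{-i}$ and a set $F \subseteq \mathbf{T}^i_i$ are regarded as sets of states through their cylinders; in particular $\mathrm{Bel}_i(E_{-i}) = \{ t_i : \boldsymbol\beta^i_i(t_i)(E_{-i})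 = 1 \}$. Agent $i$'s *events* are the closed sets $E_{-i} \subseteq \Theta \times \mathbf{T}^i_{-i}$. **Proposition.** For every state space $\Omega$, every agent $i \in I$ and every agent-$i$-dependent type structure induced by $T_i$: 1. (Necessitation) $B_i(\Theta \times \mathbf{T}^i_{-i}) = T_i$; 2. (Monotonicity) for all events $E_{-i} \subseteq E'_{-i}$, $B_i(E_{-i}) \subseteq B_i(E'_{-i})$; 3. (Conjunction) for all events $E_{-i}, E'_{-i}$, $B_i(E_{-i}) \cap B_i(E'_{-i}) = B_i(E_{-i} \cap E'_{-i})$; 4. (Positive introspection) for every event $E_{-i}$, $B_i(B_i(E_{-i})) = B_i(E_{-i})$; 5. (Negative introspection) for every event $E_{-i}$, $B_i(T_i \setminus B_i(E_{-i})) = T_i \setminus B_i(E_{-i})$; and also $B_i(\mathbf{T}^i_i \setminus B_i(E_{-i})) = T_i \setminus B_i(E_{-i})$. -/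

import Mathlib

open MeasureTheory

universe u

noncomputable section

namespace Misalignment

/-! ### Beliefs on topological spaces -/

/-- `Prob X`, written `Δ(X)` in game theory: the regular probability measures on the Borel
`σ`-algebra of `X`.  (On a compact metrizable space every Borel probability measure is regular.) -/
structure Prob (X : Type u) [TopologicalSpace X] : Type u where
  toProbabilityMeasure : @ProbabilityMeasure X (borel X)
  regular : @Measure.Regular X (borel X) _
    (@ProbabilityMeasure.toMeasure X (borel X) toProbabilityMeasure)

/-- The underlying Borel measure. -/
def Prob.toMeasure {X : Type u} [TopologicalSpace X] (μ : Prob X) : @Measure X (borel X) :=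
  @ProbabilityMeasure.toMeasure X (borel X) μ.toProbabilityMeasure

/-- The topology of weak convergence of probability measures. -/
instance Prob.instTopologicalSpace (X : Type u) [TopologicalSpace X] :
    TopologicalSpace (Prob X) :=
  letI : MeasurableSpace X := borel X
  haveI : BorelSpace X := ⟨rfl⟩
  TopologicalSpace.induced (fun μ : Prob X => μ.toProbabilityMeasure) inferInstance

/-- The image of a Borel measure under a continuous map.  When the map is a projection this is the
marginal. -/
def marg {X Y : Type u} [TopologicalSpace X] [TopologicalSpace Y] (f : C(X, Y))
    (μ : @Measure X (borel X)) : @Measure Y (borel Y) :=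
  @Measure.map X Y (borel X) (borel Y) f μ

/-- The product `X_{-i} = ∏_{j ≠ i} X_j`. -/
abbrev Others {I : Type} (X : I → Type u) (i : I) : Type u := ∀ j : {j : I // j ≠ i}, X j

/-- The map `Θ × X_{-i} → Θ × Y_{-i}` that is the identity on `Θ` and acts by `f j` on the
coordinate `j`. -/
def mapOthers {I : Type} (Θ : Type u) [TopologicalSpace Θ] {X Y : I → Type u}
    [∀ j, TopologicalSpace (X j)] [∀ j, TopologicalSpace (Y j)] (f : ∀ j, C(X j, Y j)) (i : I) :
    C(Θ × Others X i, Θ × Others Y i) where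
  toFun p := (p.1, fun j => f j (p.2 j))
  continuous_toFun := by fun_prop

/-! ### Infinite coherent hierarchies of beliefs -/

/-- One stage of the construction of the hierarchies: for every agent `i`, the domain of
uncertainty `Ω^m_i`, the space `T^m_i` of coherent hierarchies of length `m`, the last entry
`μ^m_i ∈ Δ(Ω^m_i)` of such a hierarchy, and the projection from the next domain of uncertainty
`Ω^{m+1}_i = Θ × T^m_{-i}` to `Ω^m_i`. -/
structure Stage (I : Type) (Θ : Type u) [TopologicalSpace Θ] where
  dom : I → Type u
  [topDom : ∀ i, TopologicalSpace (dom i)]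
  hier : I → Type u
  [topHier : ∀ i, TopologicalSpace (hier i)]
  last : ∀ i, hier i → Prob (dom i)
  proj : ∀ i, C(Θ × Others hier i, dom i)

attribute [instance] Stage.topDom Stage.topHier

/-- The first stage: `Ω^1_i = Θ` and `T^1_i = Δ(Θ)`. -/
def Stage.first (I : Type) (Θ : Type u) [TopologicalSpace Θ] : Stage I Θ where
  dom _ := Θ
  hier _ := Prob Θ
  last _ μ := μ
  proj _ := ⟨Prod.fst, continuous_fst⟩

/-- The space `T^{m+1}_i` of the pairs of a hierarchy in `T^m_i` and a measure in
`Δ(Θ × T^m_{-i})` whose marginal on `Ω^m_i` is the last entry of the hierarchy. -/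
abbrev Stage.NextHier {I : Type} {Θ : Type u} [TopologicalSpace Θ] (S : Stage I Θ) (i : I) :
    Type u :=
  {p : S.hier i × Prob (Θ × Others S.hier i) //
    marg (S.proj i) p.2.toMeasure = (S.last i p.1).toMeasure}

/-- Forgetting the last entry of a hierarchy. -/
def Stage.forget {I : Type} {Θ : Type u} [TopologicalSpace Θ] (S : Stage I Θ) (i : I) :
    C(S.NextHier i, S.hier i) where
  toFun p := p.1.1
  continuous_toFun := by fun_prop

/-- The stage `m + 1` from the stage `m`. -/
def Stage.next {I : Type} {Θ : Type u} [TopologicalSpace Θ] (S : Stage I Θ) : Stage I Θ where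
  dom i := Θ × Others S.hier i
  hier i := S.NextHier i
  last _ p := p.1.2
  proj i := mapOthers Θ S.forget i

/-- The sequence of stages.  Stages are counted from `0`, so `stage I Θ m` holds the hierarchies of
length `m + 1`. -/
def stage (I : Type) (Θ : Type u) [TopologicalSpace Θ] : ℕ → Stage I Θ
  | 0 => Stage.first I Θ
  | m + 1 => (stage I Θ m).next

/-- The universal type space `T*_i`: the inverse limit of the spaces `T^m_i`. -/
abbrev UType {I : Type} (Θ : Type u) [TopologicalSpace Θ] (i : I) : Type u :=
  {t : ∀ m, (stage I Θ m).hier i // ∀ m, (stage I Θ m).forget i (t (m + 1)) = t m}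

/-- The projection of a universal type to its first entries. -/
def UType.trunc {I : Type} {Θ : Type u} [TopologicalSpace Θ] (m : ℕ) (i : I) :
    C(UType Θ i, (stage I Θ m).hier i) where
  toFun t := t.1 m
  continuous_toFun := (continuous_apply m).comp continuous_subtype_val

/-- The hierarchy function: the entries of a universal type. -/
def UType.level {I : Type} {Θ : Type u} [TopologicalSpace Θ] {i : I} (t : UType Θ i) (m : ℕ) :
    Prob ((stage I Θ m).dom i) :=
  (stage I Θ m).last i (t.1 m)

/-- The projection `Θ × T*_{-i} → Ω^m_i`. -/
def toDom {I : Type} (Θ : Type u) [TopologicalSpace Θ] (m : ℕ) (i : I) :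
    C(Θ × Others (fun j : I => UType Θ j) i, (stage I Θ m).dom i) :=
  ((stage I Θ m).proj i).comp (mapOthers Θ (fun j => UType.trunc m j) i)

/-- `ν` is the belief `β*_i(t)` on `Θ × T*_{-i}` of the universal type `t`: its marginals are the
entries of the hierarchy `t`. -/
def IsUniversalBelief {I : Type} {Θ : Type u} [TopologicalSpace Θ] {i : I} (t : UType Θ i)
    (ν : @Measure (Θ × Others (fun j : I => UType Θ j) i) (borel _)) : Prop :=
  ∀ m, marg (toDom Θ m i) ν = (t.level m).toMeasure

/-! ### State spaces and type structures -/

/-- A state space: a nonempty compact subset `Θ × ∏_j T_j` of the universal state space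
`Θ × ∏_j T*_j`.  It need not be belief-closed. -/
structure StateSpace (I : Type) (Θ : Type u) [TopologicalSpace Θ] where
  T : ∀ j : I, Set (UType Θ j)
  nonempty : (Set.univ ×ˢ Set.univ.pi T : Set (Θ × ∀ j, UType Θ j)).Nonempty
  isCompact : IsCompact (Set.univ ×ˢ Set.univ.pi T : Set (Θ × ∀ j, UType Θ j))

/-- A (non-redundant) type structure: nonempty compact sets `T_j ⊆ T*_j` and continuous belief
functions `β_j : T_j → Δ(Θ × T_{-j})` that are the restrictions of `β*_j`. -/
structure TypeStructure (I : Type) (Θ : Type u) [TopologicalSpace Θ] where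
  T : ∀ j : I, Set (UType Θ j)
  nonempty : ∀ j, (T j).Nonempty
  isCompact : ∀ j, IsCompact (T j)
  β : ∀ j, C(T j, Prob (Θ × Others (fun k => T k) j))
  isUniversalBelief : ∀ j (t : T j), IsUniversalBelief t.1
    (marg (mapOthers Θ (fun k => ⟨(Subtype.val : T k → UType Θ k), continuous_subtype_val⟩) j)
      (β j t).toMeasure)

namespace TypeStructure

variable {I : Type} {Θ : Type u} [TopologicalSpace Θ] (S : TypeStructure I Θ)

/-- The states `Θ × ∏_j T_j` of the (belief-closed) state space induced by a type structure. -/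
abbrev State : Type u := Θ × ∀ j, S.T j

/-- The pairs in `Θ × T_{-i}` about which agent `i` has beliefs. -/
abbrev OthersState (i : I) : Type u := Θ × Others (fun k => S.T k) i

/-- Agent `i`'s events: closed subsets of `Θ × T_{-i}`. -/
def IsEvent (i : I) (E : Set (S.OthersState i)) : Prop := IsClosed E

open Classical in
/-- The section `{(θ, t_{-i}) | (θ, t_i, t_{-i}) ∈ E}` at the type `t_i = t` of agent `i`. -/
def sectionAt (i : I) (t : S.T i) (E : Set S.State) : Set (S.OthersState i) :=
  {p | (p.1, (Equiv.piSplitAt i (fun j => (S.T j : Type u))).symm (t, p.2)) ∈ E}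

/-- The subset `E ⊆ Θ × T_{-i}` as a set of states. -/
def aboutOthers (i : I) (E : Set (S.OthersState i)) : Set S.State :=
  {ω | (ω.1, fun j : {j : I // j ≠ i} => ω.2 j) ∈ E}

/-- The set `F ⊆ T_i` of types of agent `i` as a set of states. -/
def aboutSelf (i : I) (F : Set (S.T i)) : Set S.State := {ω | ω.2 i ∈ F}

/-- The belief operator of agent `i`, as a set of types of agent `i`.  The agent knows her own
type, so the type `t` gives a set of states the probability that `β_i(t)` gives to its section at
`t`; for a set `E ⊆ Θ × T_{-i}` this is `β_i(t)(E)`, see `mem_Bel_aboutOthers`. -/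
def Bel (i : I) (E : Set S.State) : Set (S.T i) :=
  {t | (S.β i t).toMeasure (S.sectionAt i t E) = 1}

theorem mem_Bel_aboutOthers (i : I) (E : Set (S.OthersState i)) (t : S.T i) :
    t ∈ S.Bel i (S.aboutOthers i E) ↔ (S.β i t).toMeasure E = 1 := by
  have h : S.sectionAt i t (S.aboutOthers i E) = E := by
    ext p
    have hp : ∀ j : {j : I // j ≠ i}, (j : I) ≠ i := fun j => j.2
    simp [sectionAt, aboutOthers, Equiv.piSplitAt, hp]
  rw [Bel, Set.mem_ofPred_eq, h]

end TypeStructure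

/-- An agent-`i`-dependent type structure induced by the set `T_i` of the state space `Ω`. -/
structure AgentTypeStructure {I : Type} {Θ : Type u} [TopologicalSpace Θ] (Ω : StateSpace I Θ)
    (i : I) extends TypeStructure I Θ where
  real_subset : Ω.T i ⊆ T i

namespace AgentTypeStructure

variable {I : Type} {Θ : Type u} [TopologicalSpace Θ] {Ω : StateSpace I Θ} {i : I}
  (S : AgentTypeStructure Ω i)

/-- The real types `T_i` of agent `i`, as a subset of the agent-dependent type space. -/
def real : Set (S.T i) := {t | t.1 ∈ Ω.T i}

/-- The misalignment-adapted belief operator: the belief operator on the agent-dependent state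
space, restricted to the real types. -/
def B (E : Set S.State) : Set (S.T i) := S.Bel i E ∩ S.real

end AgentTypeStructure

end Misalignment

end

namespace Misalignment

theorem Prob.toMeasure_univ {X : Type u} [TopologicalSpace X] (μ : Prob X) :
    μ.toMeasure Set.univ = 1 :=
  let : MeasurableSpace X := borel X
  measure_univ (μ := (μ.toProbabilityMeasure : Measure X))

theorem Prob.toMeasure_eq_one_of_subset {X : Type u} [TopologicalSpace X] (μ : Prob X)
    {E F : Set X} (hEF : E ⊆ F) (hE : μ.toMeasure E = 1) : μ.toMeasure F = 1 := by
  let : MeasurableSpace X := borel X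
  refine le_antisymm ?_ ?_
  · rw [← μ.toMeasure_univ]
    exact measure_mono (Set.subset_univ F)
  · rw [← hE]
    exact measure_mono hEF

/-- For a probability measure, a closed set has full measure iff its complement is null. -/
theorem Prob.toMeasure_eq_one_iff {X : Type u} [TopologicalSpace X] (μ : Prob X) {E : Set X}
    (hE : IsClosed E) : μ.toMeasure E = 1 ↔ μ.toMeasure Eᶜ = 0 := by
  let : MeasurableSpace X := borel X
  have : BorelSpace X := ⟨rfl⟩
  have : IsProbabilityMeasure μ.toMeasure := ⟨μ.toMeasure_univ⟩
  exact (prob_compl_eq_zero_iff hE.measurableSet).symm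

theorem Prob.toMeasure_inter_eq_one_iff {X : Type u} [TopologicalSpace X] (μ : Prob X)
    {E F : Set X} (hE : IsClosed E) (hF : IsClosed F) :
    μ.toMeasure (E ∩ F) = 1 ↔ μ.toMeasure E = 1 ∧ μ.toMeasure F = 1 := by
  let : MeasurableSpace X := borel X
  rw [μ.toMeasure_eq_one_iff (hE.inter hF), μ.toMeasure_eq_one_iff hE, μ.toMeasure_eq_one_iff hF,
    Set.compl_inter, measure_union_null_iff]

namespace TypeStructure

variable {I : Type} {Θ : Type u} [TopologicalSpace Θ] (S : TypeStructure I Θ)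

/-- The agent knows her own type: she believes a set of her own types exactly when her type lies
in it. -/
theorem Bel_aboutSelf (i : I) (F : Set (S.T i)) : S.Bel i (S.aboutSelf i F) = F := by
  ext t
  by_cases ht : t ∈ F
  · have h : S.sectionAt i t (S.aboutSelf i F) = Set.univ := by
      ext p
      simp [sectionAt, aboutSelf, Equiv.piSplitAt, ht]
    simp [Bel, h, ht, Prob.toMeasure_univ]
  · have h : S.sectionAt i t (S.aboutSelf i F) = ∅ := by
      ext p
      simp [sectionAt, aboutSelf, Equiv.piSplitAt, ht]
    simp [Bel, h, ht]

end TypeStructure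

namespace AgentTypeStructure

variable {I : Type} {Θ : Type u} [TopologicalSpace Θ] {Ω : StateSpace I Θ} {i : I}
  (S : AgentTypeStructure Ω i)

theorem mem_B_aboutOthers (E : Set (S.OthersState i)) (t : S.T i) :
    t ∈ S.B (S.aboutOthers i E) ↔ (S.β i t).toMeasure E = 1 ∧ t ∈ S.real :=
  and_congr_left fun _ => S.mem_Bel_aboutOthers i E t

theorem B_aboutSelf (F : Set (S.T i)) : S.B (S.aboutSelf i F) = F ∩ S.real := by
  rw [B, S.Bel_aboutSelf]

theorem B_subset_real (E : Set S.State) : S.B E ⊆ S.real := Set.inter_subset_right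

end AgentTypeStructure

end Misalignment

theorem mainTheorem4 {I : Type} [Finite I] {Θ : Type u} [TopologicalSpace Θ] [CompactSpace Θ]
    (Ω : Misalignment.StateSpace I Θ) (i : I) (S : Misalignment.AgentTypeStructure Ω i) :
    -- Necessitation
    S.B (S.aboutOthers i Set.univ) = S.real ∧
    -- Monotonicity
    (∀ E E' : Set (S.OthersState i), S.IsEvent i E → S.IsEvent i E' → E ⊆ E' →
      S.B (S.aboutOthers i E) ⊆ S.B (S.aboutOthers i E')) ∧
    -- Conjunction
    (∀ E E' : Set (S.OthersState i), S.IsEvent i E → S.IsEvent i E' →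
      S.B (S.aboutOthers i E) ∩ S.B (S.aboutOthers i E') = S.B (S.aboutOthers i (E ∩ E'))) ∧
    -- Positive introspection
    (∀ E : Set (S.OthersState i), S.IsEvent i E →
      S.B (S.aboutSelf i (S.B (S.aboutOthers i E))) = S.B (S.aboutOthers i E)) ∧
    -- Negative introspection, with the complement taken in the set of real types
    (∀ E : Set (S.OthersState i), S.IsEvent i E →
      S.B (S.aboutSelf i (S.real \ S.B (S.aboutOthers i E))) =
        S.real \ S.B (S.aboutOthers i E)) ∧
    -- The same with the inner complement taken in the agent-dependent type space
    (∀ E : Set (S.OthersState i), S.IsEvent i E →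
      S.B (S.aboutSelf i (S.B (S.aboutOthers i E))ᶜ) =
        S.real \ S.B (S.aboutOthers i E)) := by
  refine ⟨?_, fun E E' _ _ hEE' t => ?_, fun E E' hE hE' => ?_, fun E _ => ?_, fun E _ => ?_,
    fun E _ => ?_⟩
  · ext t
    simp [S.mem_B_aboutOthers, Misalignment.Prob.toMeasure_univ]
  · simp only [S.mem_B_aboutOthers]
    exact And.imp_left ((S.β i t).toMeasure_eq_one_of_subset hEE')
  · ext t
    rw [Set.mem_inter_iff]
    simp only [S.mem_B_aboutOthers, (S.β i t).toMeasure_inter_eq_one_iff hE hE']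
    exact and_and_right.symm
  · rw [S.B_aboutSelf]
    exact Set.inter_eq_left.2 (S.B_subset_real _)
  · rw [S.B_aboutSelf]
    exact Set.inter_eq_left.2 Set.sdiff_subset
  · rw [S.B_aboutSelf, Set.inter_comm, Set.sdiff_eq]
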